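/- Theorem. Let $E$ be an Archimedean real vector lattice (i.e. if $x,y\in E$ and $nx\le y$ for all $n\in\mathbb N$, then $x\le 0$), and let $F$ be a vector sublattice of $E$ (a linear subspace closed under the lattice operations of $E$) which is order dense in $E$: for every $x\in E$ with $x>0$ there is $y\in F$ with $0<y\le x$. A vector lattice is said to have the countable sup property if every nonempty subset that possesses a supremum in the lattice contains a countable subset possessing the same supremum. Suppose that $F$ (with the order and lattice operations induced from $E$) has the countable sup property. Then $E$ has the countable sup property in each of the following cases: (a) $F$ is majorizing in $E$, i.e. for every $x\in E$ there is $y\in F$ with $x\le y$; (b) $F$ has a weak unit, i.e. there is $e\in F$ with $e\ge 0$ such that for $x\in F$, $|x|\wedge e=0$ implies $x=0$. -/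

import Mathlib

/-- `E` is Archimedean in the sense of ordered vector spaces: if the multiples `n • x`, `n ∈ ℕ`,
are all bounded above by one `y`, then `x ≤ 0`.  (Mathlib's class `Archimedean` is a different
notion: it forces every `x > 0` to be a strong unit.) -/
def IsArchimedeanOrdered (E : Type*) [AddCommGroup E] [Preorder E] : Prop :=
  ∀ x y : E, (∀ n : ℕ, n • x ≤ y) → x ≤ 0

/-- Every nonempty subset possessing a supremum contains a countable subset possessing the same
supremum. -/
def HasCountableSupProperty (E : Type*) [Preorder E] : Prop :=
  ∀ (S : Set E) (x : E), S.Nonempty → IsLUB S x → ∃ T ⊆ S, T.Countable ∧ IsLUB T x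

section VectorSublattice

variable {E : Type*} [AddCommGroup E] [Lattice E] [Module ℝ E]

/-- A vector sublattice: a linear subspace closed under the binary suprema and infima of `E`. -/
def IsVectorSublattice (F : Submodule ℝ E) : Prop :=
  IsSublattice (F : Set E)

/-- `F` is order dense in `E`: below every `x > 0` of `E` there is some `y > 0` of `F`. -/
def IsOrderDense (F : Submodule ℝ E) : Prop :=
  ∀ x : E, 0 < x → ∃ y ∈ F, 0 < y ∧ y ≤ x

/-- `F` is majorizing in `E`: every element of `E` lies below some element of `F`. -/
def IsMajorizing (F : Submodule ℝ E) : Prop :=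
  ∀ x : E, ∃ y ∈ F, x ≤ y

/-- `e` is a weak unit of the vector sublattice `F`; the lattice operations of `F` are the
restrictions of those of `E`.  Only `x` in `F` are tested. -/
def IsWeakUnitOf (F : Submodule ℝ E) (e : E) : Prop :=
  e ∈ F ∧ 0 ≤ e ∧ ∀ x ∈ F, |x| ⊓ e = 0 → x = 0

end VectorSublattice

section OrderDense

variable {E : Type*} [AddCommGroup E] [Lattice E] [IsOrderedAddMonoid E] [Module ℝ E]

/-! The differences `x - s` have infimum `0`, so for `0 ≤ y ∈ F` the positive elements of `F` below
some `(y - (x - s))⁺` have supremum `y` in `F`. Countably many of them suffice, and the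
corresponding `s` force every positive lower bound `c` of the `x - s` to satisfy `c ⊓ y = 0`. Then
`c = 0` if `y` dominates some `x - s₀`, or if `y` is a weak unit. -/

/-- In an Archimedean vector lattice, a positive element is the least upper bound of the positive
elements of an order dense subspace that lie below it. -/
theorem IsOrderDense.le_of_forall_le (hE : IsArchimedeanOrdered E) {F : Submodule ℝ E}
    (hF : IsOrderDense F) {x u : E} (hx : 0 ≤ x) (hu : ∀ b ∈ F, 0 ≤ b → b ≤ x → b ≤ u) :
    x ≤ u := by
  by_contra hxu
  have hw : 0 < x - u ⊓ x :=
    lt_of_le_of_ne (sub_nonneg.2 inf_le_right) fun h =>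
      hxu (inf_eq_right.1 (sub_eq_zero.1 h.symm).symm)
  obtain ⟨z, hzF, hz, hzw⟩ := hF _ hw
  -- Bootstrapping: `n • z ≤ x` forces `n • z ≤ u ⊓ x`, which leaves room for one more `z`.
  have hn : ∀ n : ℕ, n • z ≤ x := by
    intro n
    induction n with
    | zero => simpa using hx
    | succ n ih =>
      have h : n • z ≤ u ⊓ x := le_inf (hu _ (F.nsmul_mem hzF n) (nsmul_nonneg hz.le n) ih) ih
      calc (n + 1) • z = n • z + z := succ_nsmul z n
        _ ≤ u ⊓ x + (x - u ⊓ x) := add_le_add h hzw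
        _ = x := add_sub_cancel _ _
  exact hz.not_ge (hE z x hn)

/-- If `x` is the supremum of `S` and `y ≥ 0` lies in an order dense subspace with the countable
sup property, then countably many elements of `S` suffice to make every positive lower bound of
the differences `x - s` disjoint from `y`. -/
theorem IsOrderDense.exists_countable_forall_inf_eq_zero (hE : IsArchimedeanOrdered E)
    {F : Submodule ℝ E} (hF : IsOrderDense F) (hcsp : HasCountableSupProperty F) {S : Set E}
    {x : E} (hS : S.Nonempty) (hx : IsLUB S x) {y : E} (hyF : y ∈ F) (hy : 0 ≤ y) :
    ∃ T ⊆ S, T.Countable ∧ ∀ c : E, 0 ≤ c → (∀ s ∈ T, c ≤ x - s) → c ⊓ y = 0 := by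
  obtain ⟨s₀, hs₀⟩ := hS
  let B : Set F := {b | 0 ≤ (b : E) ∧ ∃ s ∈ S, (b : E) ≤ (y - (x - s)) ⊔ 0}
  have hB : IsLUB B ⟨y, hyF⟩ := by
    constructor
    · rintro b ⟨-, s, hs, hb⟩
      exact hb.trans (sup_le (sub_le_self _ (sub_nonneg.2 (hx.1 hs))) hy)
    · intro u hu
      have key : ∀ s ∈ S, y - (x - s) ≤ (u : E) := fun s hs =>
        le_sup_left.trans <| hF.le_of_forall_le hE le_sup_right fun b hbF hb hbs =>
          hu (show (⟨b, hbF⟩ : F) ∈ B from ⟨hb, s, hs, hbs⟩)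
      have hxu : x ≤ u - y + x := hx.2 fun s hs => by
        have h := add_le_add_left (key s hs) (x - y)
        calc s = y - (x - s) + (x - y) := by abel
          _ ≤ u + (x - y) := h
          _ = u - y + x := by abel
      exact sub_nonneg.1 (le_add_iff_nonneg_left x |>.1 hxu)
  obtain ⟨T, hTB, hT, hTy⟩ := hcsp B _ ⟨0, le_rfl, s₀, hs₀, le_sup_right⟩ hB
  choose! f hfS hf using fun t (ht : t ∈ T) => (hTB ht).2
  refine ⟨f '' T, Set.image_subset_iff.2 hfS, hT.image f, fun c hc hcT => ?_⟩
  by_contra hne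
  obtain ⟨z, hzF, hz, hzc⟩ := hF (c ⊓ y) (lt_of_le_of_ne (le_inf hc hy) (Ne.symm hne))
  -- Since `z ≤ c ⊓ y`, each `(y - (x - s))⁺` with `s` chosen is at most `y - z`, an upper bound
  -- lying in `F`.
  have hyz : (⟨y, hyF⟩ : F) ≤ ⟨y - z, F.sub_mem hyF hzF⟩ := hTy.2 fun t ht =>
    (hf t ht).trans <| sup_le
      (sub_le_sub_left ((hzc.trans inf_le_left).trans (hcT _ (Set.mem_image_of_mem f ht))) y)
      (sub_nonneg.2 (hzc.trans inf_le_right))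
  exact hz.not_ge (le_sub_self_iff y |>.1 hyz)

end OrderDense

/-- For an upper bound `u`, the element `x - u ⊓ x` is itself a positive lower bound of the
differences. -/
theorem isLUB_of_forall_nonneg_le_sub {E : Type*} [AddCommGroup E] [Lattice E]
    [IsOrderedAddMonoid E] {T : Set E} {x : E} (hx : x ∈ upperBounds T)
    (h : ∀ c : E, 0 ≤ c → (∀ s ∈ T, c ≤ x - s) → c = 0) : IsLUB T x := by
  refine ⟨hx, fun u hu => ?_⟩
  have := h (x - u ⊓ x) (sub_nonneg.2 inf_le_right)
    fun s hs => sub_le_sub_left (le_inf (hu hs) (hx hs)) x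
  exact inf_eq_right.1 (sub_eq_zero.1 this).symm

theorem mainTheorem5 {E : Type*} [AddCommGroup E] [Lattice E] [IsOrderedAddMonoid E]
    [Module ℝ E] [IsOrderedModule ℝ E] (hE : IsArchimedeanOrdered E)
    (F : Submodule ℝ E) (hF : IsVectorSublattice F) (hdense : IsOrderDense F)
    (hcsp : HasCountableSupProperty F) :
    (IsMajorizing F → HasCountableSupProperty E) ∧
      ((∃ e : E, IsWeakUnitOf F e) → HasCountableSupProperty E) := by
  constructor
  · intro hmaj S x hS hx
    obtain ⟨s₀, hs₀⟩ := id hS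
    obtain ⟨y, hyF, hy⟩ := hmaj (x - s₀)
    obtain ⟨T, hTS, hT, h⟩ := hdense.exists_countable_forall_inf_eq_zero hE hcsp hS hx hyF
      ((sub_nonneg.2 (hx.1 hs₀)).trans hy)
    -- Adjoining `s₀` gives `c ≤ x - s₀ ≤ y`, so `c = c ⊓ y`.
    have hsub : insert s₀ T ⊆ S := Set.insert_subset hs₀ hTS
    refine ⟨insert s₀ T, hsub, hT.insert s₀,
      isLUB_of_forall_nonneg_le_sub (fun s hs => hx.1 (hsub hs)) fun c hc hcT => ?_⟩
    rw [← h c hc fun s hs => hcT s (Set.mem_insert_of_mem _ hs)]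
    exact (inf_eq_left.2 ((hcT s₀ (Set.mem_insert _ _)).trans hy)).symm
  · rintro ⟨e, heF, he, hunit⟩ S x hS hx
    obtain ⟨T, hTS, hT, h⟩ := hdense.exists_countable_forall_inf_eq_zero hE hcsp hS hx heF he
    refine ⟨T, hTS, hT,
      isLUB_of_forall_nonneg_le_sub (fun s hs => hx.1 (hTS hs)) fun c hc hcT => ?_⟩
    by_contra hne
    obtain ⟨z, hzF, hz, hzc⟩ := hdense c (lt_of_le_of_ne hc (Ne.symm hne))
    refine hz.ne' (hunit z hzF ?_)
    rw [abs_of_nonneg hz.le]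
    exact le_antisymm ((inf_le_inf_right e hzc).trans (h c hc hcT).le) (le_inf hz.le he)
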